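/- Languages are relational, with all predicate symbols of arity at least $1$, and structures are nonempty. For structures $\mathcal{A}_i$, $i\in I$, in a language $\Sigma$, their $E$-combination is the structure in the language $\Sigma\cup\{E\}$ ($E\notin\Sigma$ binary) which is the disjoint union of the $\mathcal{A}_i$ (each predicate of $\Sigma$ being the union of its interpretations in the $\mathcal{A}_i$), expanded by the equivalence relation $E$ whose classes are the universes of the $\mathcal{A}_i$. For a set $\mathcal{T}$ of complete theories in $\Sigma$, ${\rm Cl}_E(\mathcal{T})$ is the set of all $\Sigma$-theories of (the restrictions to) $E$-classes of structures elementarily equivalent to an $E$-combination of some structures $\mathcal{A}_i$ with ${\rm Th}(\mathcal{A}_i)\in\mathcal{T}$. The set $\mathcal{T}$ is $E$-closed if $\mathcal{T}={\rm Cl}_E(\mathcal{T})$. A generating set of an $E$-closed set $\mathcal{T}$ is a subset $\mathcal{G}\subseteq\mathcal{T}$ with ${\rm Cl}_E(\mathcal{G})=\mathcal{T}$; it is minimal if no proper subset of it is generating, and a minimal generating set is least if it is contained in every generating set of $\mathcal{T}$. For $\Sigma_0\subseteq\Sigma$, families $\mathcal{T}_j$, $j\in J$, of complete theories in $\Sigma$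 are $\Sigma_0$-disjoint if for all $j_1\neq j_2$, $T_1\in\mathcal{T}_{j_1}$, $T_2\in\mathcal{T}_{j_2}$, there is no predicate symbol $R\in\Sigma\setminus\Sigma_0$ with $\exists\bar{x}\,R(\bar{x})$ belonging to both $T_1$ and $T_2$. **Corollary 3.13.** Let $\Sigma_0$ be an infinite language and let $\Sigma\supseteq\Sigma_0$ be any language. Then there are $\Sigma_0$-disjoint families $\mathcal{T}_j$, $j\in J$, of complete theories in $\Sigma$, each $E$-closed and having the least generating set, such that the union $\bigcup_{j\in J}\mathcal{T}_j$ is $E$-closed and does not have the least generating set. -/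

import Mathlib

universe u v

namespace EComb

/-- The only symbol of the language of one equivalence relation: a binary predicate. -/
inductive EqSymbol : ℕ → Type
  | E : EqSymbol 2

/-- The language `{E}` with a single binary predicate symbol `E`. -/
def eqLang : FirstOrder.Language.{0, 0} := ⟨fun _ => Empty, EqSymbol⟩

/-- The interpretation of `E` in an `{E}`-structure. -/
def ERel {M : Type*} [eqLang.Structure M] (a b : M) : Prop :=
  FirstOrder.Language.Structure.RelMap (L := eqLang) EqSymbol.E ![a, b]

/-- The universe of the `E`-combination of a family of structures: their disjoint union. -/
def Comb {I : Type*} (A : I → Type*) : Type _ := Σ i, A i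

/-- The `E`-classes of the `E`-combination are exactly the universes of the summands. -/
instance combEq {I : Type*} (A : I → Type*) : eqLang.Structure (Comb A) where
  funMap := fun f => nomatch f
  RelMap := fun R => match R with
    | EqSymbol.E => fun x => (x 0).1 = (x 1).1

/-- The predicates of the `E`-combination are the unions of the predicates of the summands. -/
instance combStructure (L : FirstOrder.Language.{u, v}) [L.IsRelational] {I : Type*} (A : I → Type*)
    [∀ i, L.Structure (A i)] : L.Structure (Comb A) where
  funMap := fun f => isEmptyElim f
  RelMap := fun R x =>
    ∃ (i : I) (y : Fin _ → A i), (x = fun k => (⟨i, y k⟩ : Comb A)) ∧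
      FirstOrder.Language.Structure.RelMap R y

/-- The restriction of a structure in the language `L ∪ {E}` to the `E`-class of `a`,
as an `L`-structure. -/
def eClass (L : FirstOrder.Language.{u, v}) [L.IsRelational] {M : Type*} [L.Structure M]
    [eqLang.Structure M] (a : M) : L.Substructure M where
  carrier := {b | ERel a b}
  fun_mem := fun f => isEmptyElim f

/-- The complete elementary theories in the language `L` (as deductively closed sets of
sentences). -/
def CTheory (L : FirstOrder.Language.{u, v}) : Type (max u v) := {T : L.Theory // T.IsMaximal}

variable {L : FirstOrder.Language.{u, v}}

/-- The `E`-closure of a set `𝒯` of complete theories: all theories of `E`-classes of structures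
`M` that are elementarily equivalent, in the language `L ∪ {E}`, to an `E`-combination of
structures whose theories lie in `𝒯`. (By the Löwenheim-Skolem theorem it does not
matter that all structures are taken in the universe of the `L`-sentences.) -/
def ClE [L.IsRelational] (𝒯 : Set (CTheory L)) : Set (CTheory L) :=
  {T | ∃ (I : Type (max u v)) (A : I → Type (max u v)) (_ : ∀ i, L.Structure (A i))
      (M : Type (max u v)) (_ : L.Structure M) (_ : eqLang.Structure M) (a : M),
      (∀ i, Nonempty (A i)) ∧
      (∀ i, ∃ S ∈ 𝒯, L.completeTheory (A i) = S.1) ∧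
      (L.sum eqLang).ElementarilyEquivalent M (Comb A) ∧
      L.completeTheory (eClass L a) = T.1}

/-- `𝒯` is `E`-closed. -/
def IsEClosed [L.IsRelational] (𝒯 : Set (CTheory L)) : Prop := 𝒯 = ClE 𝒯

/-- `𝒢` is a generating set for `𝒯`. -/
def IsGeneratingSet [L.IsRelational] (𝒢 𝒯 : Set (CTheory L)) : Prop :=
  𝒢 ⊆ 𝒯 ∧ 𝒯 = ClE 𝒢

/-- `𝒢` is a minimal generating set for `𝒯`. -/
def IsMinimalGeneratingSet [L.IsRelational] (𝒢 𝒯 : Set (CTheory L)) : Prop :=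
  IsGeneratingSet 𝒢 𝒯 ∧ ∀ 𝒢', 𝒢' ⊂ 𝒢 → ¬ IsGeneratingSet 𝒢' 𝒯

/-- `𝒢` is the least generating set for `𝒯`. -/
def IsLeastGeneratingSet [L.IsRelational] (𝒢 𝒯 : Set (CTheory L)) : Prop :=
  IsMinimalGeneratingSet 𝒢 𝒯 ∧ ∀ 𝒢', IsGeneratingSet 𝒢' 𝒯 → 𝒢 ⊆ 𝒢'

/-- `𝒯` has the least generating set (meant for `E`-closed `𝒯`). -/
def HasLeastGeneratingSet [L.IsRelational] (𝒯 : Set (CTheory L)) : Prop :=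
  ∃ 𝒢, IsLeastGeneratingSet 𝒢 𝒯

/-- The sentence `∃ x₁ … xₙ, R(x₁, …, xₙ)`. -/
def nonemptySentence {n : ℕ} (R : L.Relations n) : L.Sentence :=
  (R.boundedFormula (α := Empty) (fun i : Fin n => FirstOrder.Language.Term.var (Sum.inr i))).exs

/-- Two theories are disjoint modulo the set `S₀` of predicate symbols: no predicate symbol
outside `S₀` is nonempty for both of them. -/
def TheoryDisjoint (S₀ : Set (Σ n, L.Relations n)) (T₁ T₂ : CTheory L) : Prop :=
  ∀ (n : ℕ) (R : L.Relations n), (⟨n, R⟩ : Σ n, L.Relations n) ∉ S₀ →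
    ¬ (nonemptySentence R ∈ T₁.1 ∧ nonemptySentence R ∈ T₂.1)

/-- The families `𝒯 j` are disjoint modulo `S₀`. -/
def FamiliesDisjoint (S₀ : Set (Σ n, L.Relations n)) {J : Type*} (𝒯 : J → Set (CTheory L)) :
    Prop :=
  ∀ j₁ j₂, j₁ ≠ j₂ → ∀ T₁ ∈ 𝒯 j₁, ∀ T₂ ∈ 𝒯 j₂, TheoryDisjoint S₀ T₁ T₂

end EComb

/-! A one-point structure is determined up to isomorphism by the set `X` of predicates that hold in
it, so its theory can be identified with `X`. In an `E`-combination of such structures `E` is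
equality, and `ClE` becomes topological closure in the Cantor space of sets of predicates
(`ClE_image_pointTheory`). Each singleton is then closed and is its own least generating set. The
union of the singletons over all `X ⊆ S₀` is the closed subspace `𝒫 S₀`, which has no isolated
points because `S₀` is infinite. A dense subset therefore stays dense when a point is dropped
(`finClosure_diff_singleton`), so there is not even a minimal generating set. Disjointness holds
because predicates outside `S₀` are empty in all these structures. -/

namespace EComb

open FirstOrder FirstOrder.Language FirstOrder.Language.Structure Filter

universe w

/-! ### Transfer of particular sentences along elementary equivalence -/

section Sentences

variable {K : FirstOrder.Language.{u, v}} {M N : Type*} [K.Structure M] [K.Structure N]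

/-- The formula `R(x, …, x)`. -/
def diagFormula {n : ℕ} (R : K.Relations n) : K.BoundedFormula Empty 1 :=
  R.boundedFormula fun _ => Term.var (Sum.inr 0)

theorem realize_diagFormula {n : ℕ} (R : K.Relations n) (v : Empty → M) (xs : Fin 1 → M) :
    (diagFormula R).Realize v xs ↔ RelMap R fun _ => xs 0 := Iff.rfl

theorem forall_diag_iff (h : K.completeTheory M = K.completeTheory N) {n : ℕ}
    (R : K.Relations n) : (∀ x : M, RelMap R fun _ => x) ↔ ∀ x : N, RelMap R fun _ => x :=
  elementarilyEquivalent_iff.1 h (diagFormula R).all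

theorem subsingleton_iff_of_completeTheory_eq (h : K.completeTheory M = K.completeTheory N) :
    (∀ x y : M, x = y) ↔ ∀ x y : N, x = y :=
  elementarilyEquivalent_iff.1 h
    ((Term.var (Sum.inr 0) : K.Term (Empty ⊕ Fin 2)).bdEqual (Term.var (Sum.inr 1))).all.all

theorem forall_rel_imp_eq_iff (h : K.completeTheory M = K.completeTheory N)
    (R : K.Relations 2) :
    (∀ x y : M, RelMap R ![x, y] → x = y) ↔ ∀ x y : N, RelMap R ![x, y] → x = y := by
  have key := elementarilyEquivalent_iff.1 h
    ((R.boundedFormula₂ (Term.var (Sum.inr 0) : K.Term (Empty ⊕ Fin 2))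
      (Term.var (Sum.inr 1))).imp
      ((Term.var (Sum.inr 0) : K.Term (Empty ⊕ Fin 2)).bdEqual (Term.var (Sum.inr 1)))).all.all
  simpa [Sentence.Realize, Formula.Realize, BoundedFormula.realize_rel₂, Fin.snoc] using key

/-- The behaviour of `a` on finitely many diagonals is a finite conjunction of literals, so its
realizability is a single sentence. -/
theorem exists_diag_agree (h : K.completeTheory M = K.completeTheory N)
    (F : Finset (Σ n, K.Relations n)) (a : M) :
    ∃ b : N, ∀ r ∈ F, (RelMap r.2 fun _ => a) ↔ RelMap r.2 fun _ => b := by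
  classical
  let φ : F → K.BoundedFormula Empty 1 := fun r =>
    if RelMap r.1.2 fun _ => a then diagFormula r.1.2 else (diagFormula r.1.2).not
  have key := elementarilyEquivalent_iff.1 h (BoundedFormula.iInf φ).ex
  simp only [Sentence.Realize, Formula.Realize, BoundedFormula.realize_ex,
    BoundedFormula.realize_iInf] at key
  obtain ⟨b, hb⟩ := key.1 ⟨a, fun r => by
    by_cases hr : RelMap r.1.2 fun _ => a <;>
      simp [φ, hr, realize_diagFormula, Fin.snoc]⟩
  refine ⟨b, fun r hr => ?_⟩
  have := hb ⟨r, hr⟩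
  by_cases ha : RelMap r.2 fun _ => a <;>
    simpa [φ, ha, realize_diagFormula, Fin.snoc] using this

end Sentences

variable {L : FirstOrder.Language.{u, v}}

/-! ### One-point structures and their theories -/

/-- The one-point structure in which exactly the predicates in `X` hold. -/
def Point (_ : Set (Σ n, L.Relations n)) : Type w := PUnit

instance (X : Set (Σ n, L.Relations n)) : Unique (Point.{u, v, w} X) :=
  inferInstanceAs (Unique PUnit)

variable [L.IsRelational]

instance (X : Set (Σ n, L.Relations n)) : L.Structure (Point.{u, v, w} X) where
  funMap f := isEmptyElim f
  RelMap {n} R _ := ⟨n, R⟩ ∈ X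

/-- The theory of a one-point structure. -/
def pointTheory (X : Set (Σ n, L.Relations n)) : CTheory L :=
  ⟨L.completeTheory (Point.{u, v, max u v} X), completeTheory.isMaximal L _⟩

theorem completeTheory_eq_pointTheory {N : Type*} [L.Structure N] [Subsingleton N] (p : N) :
    L.completeTheory N = (pointTheory {r | RelMap r.2 fun _ => p}).1 := by
  let e : N ≃[L] Point.{u, v, max u v} {r : Σ n, L.Relations n | RelMap r.2 fun _ => p} :=
    { toFun := fun _ => default
      invFun := fun _ => p
      left_inv := fun _ => Subsingleton.elim _ _
      right_inv := fun _ => Subsingleton.elim _ _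
      map_fun' := fun f => isEmptyElim f
      map_rel' := fun {n} R x => by
        rw [Subsingleton.elim x fun _ => p]
        exact Iff.rfl }
  exact StrongHomClass.elementarilyEquivalent e

theorem subsingleton_and_relMap_iff {A : Type*} [L.Structure A] {X : Set (Σ n, L.Relations n)}
    (h : L.completeTheory A = (pointTheory X).1) :
    Subsingleton A ∧ ∀ (a : A) (r : Σ n, L.Relations n), (RelMap r.2 fun _ => a) ↔ r ∈ X := by
  have hs : ∀ x y : A, x = y :=
    (subsingleton_iff_of_completeTheory_eq h).2 fun _ _ => Subsingleton.elim _ _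
  refine ⟨⟨hs⟩, fun a r => ?_⟩
  have hr := forall_diag_iff h r.2
  constructor
  · intro ha
    exact hr.1 (fun x => hs a x ▸ ha) default
  · intro hX
    exact hr.2 (fun _ => hX) a

theorem pointTheory_injective : Function.Injective (pointTheory (L := L)) := by
  intro X Y h
  have := (subsingleton_and_relMap_iff (A := Point.{u, v, max u v} X) (X := Y)
    (congrArg Subtype.val h)).2 default
  ext r
  exact this r

section Combination

variable {I : Type*} {A : I → Type*}

theorem relMap_comb [∀ i, L.Structure (A i)] [IsEmpty (L.Relations 0)] {n : ℕ}
    (R : L.Relations n) (i : I) (y : A i) :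
    RelMap (M := Comb A) R (fun _ => ⟨i, y⟩) ↔ RelMap R fun _ => y := by
  constructor
  · rintro ⟨j, z, hz, hR⟩
    -- Positive arity is essential: the summand is read off the first coordinate, which a nullary
    -- predicate lacks.
    obtain _ | n := n
    · exact isEmptyElim R
    have h0 : i = j := congrArg Sigma.fst (congrFun hz 0)
    subst h0
    have : z = fun _ => y := by
      funext k
      exact (eq_of_heq (Sigma.mk.inj (congrFun hz k)).2).symm
    rwa [this] at hR
  · exact fun h => ⟨i, _, rfl, h⟩

theorem eRel_iff_eq [∀ i, L.Structure (A i)] {M : Type*} [L.Structure M] [eqLang.Structure M]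
    (hA : ∀ i, Subsingleton (A i))
    (hM : (L.sum eqLang).ElementarilyEquivalent M (Comb A)) (a b : M) :
    ERel a b ↔ b = a := by
  constructor
  · refine fun h => ((forall_rel_imp_eq_iff hM (Sum.inr EqSymbol.E)).2 ?_ a b h).symm
    rintro ⟨i, x⟩ ⟨j, y⟩ h
    obtain rfl : i = j := h
    exact congrArg _ (Subsingleton.elim x y)
  · rintro rfl
    have h : (![b, b] : Fin 2 → M) = fun _ => b := by
      funext k
      fin_cases k <;> rfl
    unfold ERel
    rw [h]
    exact (forall_diag_iff hM (Sum.inr EqSymbol.E : (L.sum eqLang).Relations 2)).2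
      (fun _ => rfl) b

theorem completeTheory_eClass [∀ i, L.Structure (A i)] {M : Type*} [L.Structure M]
    [eqLang.Structure M] (hA : ∀ i, Subsingleton (A i))
    (hM : (L.sum eqLang).ElementarilyEquivalent M (Comb A)) (a : M) :
    L.completeTheory (eClass L a) = (pointTheory {r | RelMap r.2 fun _ => a}).1 := by
  have hE := eRel_iff_eq hA hM a
  have : Subsingleton (eClass L a) :=
    ⟨fun x y => Subtype.ext (((hE x).1 x.2).trans ((hE y).1 y.2).symm)⟩
  exact completeTheory_eq_pointTheory (⟨a, (hE a).2 rfl⟩ : eClass L a)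

end Combination

/-- Reconciles two instances on the ultraproduct, so that Łoś's theorem applies in the sum language.
-/
theorem sumStructure_product {K₁ K₂ : FirstOrder.Language} {α : Type*} (U : Ultrafilter α)
    (M : α → Type*) [∀ i, K₁.Structure (M i)] [∀ i, K₂.Structure (M i)] :
    sumStructure K₁ K₂ ((U : Filter α).Product M) =
      Ultraproduct.structure (L := K₁.sum K₂) := by
  ext n s x
  · cases s <;> rfl
  · cases s <;> rfl

theorem elementarilyEquivalent_ultrapower {K₁ K₂ : FirstOrder.Language} {α : Type*}
    (U : Ultrafilter α) (M : Type*) [K₁.Structure M] [K₂.Structure M] [Nonempty M] :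
    (K₁.sum K₂).ElementarilyEquivalent ((U : Filter α).Product fun _ => M) M := by
  rw [elementarilyEquivalent_iff]
  intro φ
  rw [sumStructure_product]
  exact (Ultraproduct.sentence_realize φ).trans eventually_const

/-- The closure of a family of sets in the topology of agreement on finite sets. -/
def finClosure {β : Type*} (𝒳 : Set (Set β)) : Set (Set β) :=
  {X | ∀ F : Finset β, ∃ Y ∈ 𝒳, ∀ r ∈ F, r ∈ X ↔ r ∈ Y}

/-- Forward: any finite part of the diagonal type of `a` is realized in some summand. Backward: an
ultrapower of the combination realizes the limit of the approximations `Y F`. -/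
theorem ClE_image_pointTheory [IsEmpty (L.Relations 0)] (𝒳 : Set (Set (Σ n, L.Relations n))) :
    ClE (pointTheory '' 𝒳) = pointTheory '' finClosure 𝒳 := by
  ext T
  constructor
  · rintro ⟨I, A, _, M, _, _, a, -, hA, hM, hT⟩
    have hA' : ∀ i, ∃ Y ∈ 𝒳, L.completeTheory (A i) = (pointTheory Y).1 := fun i => by
      obtain ⟨_, ⟨Y, hY, rfl⟩, h⟩ := hA i
      exact ⟨Y, hY, h⟩
    choose Y hY hAY using hA'
    refine ⟨{r | RelMap r.2 fun _ => a}, fun F => ?_, Subtype.ext ?_⟩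
    · classical
      let ι : (Σ n, L.Relations n) → Σ n, (L.sum eqLang).Relations n :=
        fun r => ⟨r.1, Sum.inl r.2⟩
      obtain ⟨⟨i, y⟩, hy⟩ := exists_diag_agree hM (F.image ι) a
      refine ⟨Y i, hY i, fun r hr => ?_⟩
      exact (hy (ι r) (Finset.mem_image_of_mem _ hr)).trans
        ((relMap_comb r.2 i y).trans ((subsingleton_and_relMap_iff (hAY i)).2 y r))
    · rw [← hT, completeTheory_eClass (fun i => (subsingleton_and_relMap_iff (hAY i)).1) hM a]
  · rintro ⟨X, hX, rfl⟩
    choose Y hY hXY using hX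
    let A : ULift.{max u v} 𝒳 → Type (max u v) := fun i => Point i.down.1
    let c : Finset (Σ n, L.Relations n) → Comb A := fun F => ⟨⟨⟨Y F, hY F⟩⟩, default⟩
    have : Nonempty (Comb A) := ⟨c ∅⟩
    -- Refining `atTop` makes every fixed predicate lie in `F` for `U`-almost all `F`, where `Y F`
    -- agrees with `X`.
    let U : Ultrafilter (Finset (Σ n, L.Relations n)) := Ultrafilter.of atTop
    let a : (U : Filter (Finset (Σ n, L.Relations n))).Product fun _ => Comb A := Quotient.mk'' c
    have hM : (L.sum eqLang).ElementarilyEquivalent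
        ((U : Filter (Finset (Σ n, L.Relations n))).Product fun _ => Comb A) (Comb A) :=
      elementarilyEquivalent_ultrapower U (Comb A)
    refine ⟨_, A, inferInstance, _, inferInstance, inferInstance, a, fun i => ⟨default⟩,
      fun i => ⟨pointTheory i.down.1, ⟨_, i.down.2, rfl⟩, rfl⟩, hM, ?_⟩
    rw [completeTheory_eClass (fun i => inferInstanceAs (Subsingleton (Point _))) hM a]
    congr 2
    ext ⟨n, R⟩
    have h1 : (RelMap R fun _ => a) ↔ ∀ᶠ F in (U : Filter (Finset (Σ n, L.Relations n))), RelMap R fun _ => c F :=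
      Ultraproduct.boundedFormula_realize_cast (diagFormula R) (fun e => e.elim) fun _ => c
    have h2 : ∀ᶠ F in (U : Filter (Finset (Σ n, L.Relations n))), ((RelMap R fun _ => c F) ↔ ⟨n, R⟩ ∈ X) := by
      refine Ultrafilter.of_le atTop ?_
      filter_upwards [eventually_ge_atTop {⟨n, R⟩}] with F hF
      exact (relMap_comb R _ _).trans
        (hXY F ⟨n, R⟩ (hF (Finset.mem_singleton_self _))).symm
    exact h1.trans ((eventually_congr h2).trans eventually_const)

/-! ### Closure in the Cantor space -/

section FinClosure

variable {β : Type*}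

theorem finClosure_empty : finClosure (∅ : Set (Set β)) = ∅ := by
  ext X
  simp [finClosure]

theorem finClosure_singleton (X : Set β) : finClosure {X} = {X} := by
  ext Y
  refine ⟨fun h => ?_, ?_⟩
  · ext r
    obtain ⟨_, rfl, hr⟩ := h {r}
    exact hr r (Finset.mem_singleton_self r)
  · rintro rfl F
    exact ⟨Y, rfl, fun _ _ => Iff.rfl⟩

theorem finClosure_powerset (S : Set β) : finClosure (𝒫 S) = 𝒫 S := by
  ext X
  refine ⟨fun h r hr => ?_, fun h F => ⟨X, h, fun _ _ => Iff.rfl⟩⟩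
  obtain ⟨Y, hY, h⟩ := h {r}
  exact hY ((h r (Finset.mem_singleton_self r)).1 hr)

theorem finClosure_diff_singleton {S : Set β} (hS : S.Infinite) {𝒳 : Set (Set β)}
    (h : finClosure 𝒳 = 𝒫 S) (X : Set β) : finClosure (𝒳 \ {X}) = 𝒫 S := by
  classical
  refine subset_antisymm ?_ ?_
  · intro Y hY
    rw [← h]
    exact fun F => let ⟨Z, hZ, hF⟩ := hY F; ⟨Z, hZ.1, hF⟩
  · intro Y hY F
    obtain ⟨r, hr, hrF⟩ := hS.exists_notMem_finset F
    -- `Y'` agrees with `Y` on `F` but differs from `X` at `r`, so an approximation to it on `insert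
    -- r F` cannot be `X`.
    let Y' : Set β := {s | if s = r then s ∉ X else s ∈ Y}
    have hY' : Y' ∈ finClosure 𝒳 := by
      rw [h]
      intro s hs
      by_cases hsr : s = r
      · exact hsr ▸ hr
      · exact hY (by simpa [Y', hsr] using hs)
    obtain ⟨Z, hZ, hZF⟩ := hY' (insert r F)
    refine ⟨Z, ⟨hZ, ?_⟩, fun s hs => ?_⟩
    · rintro rfl
      have := hZF r (Finset.mem_insert_self _ _)
      simp [Y'] at this
    · have hsr : s ≠ r := fun e => hrF (e ▸ hs)
      simpa [Y', hsr] using hZF s (Finset.mem_insert_of_mem hs)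

end FinClosure

theorem mem_of_nonemptySentence_mem_pointTheory {X : Set (Σ n, L.Relations n)} {n : ℕ}
    {R : L.Relations n} (h : nonemptySentence R ∈ (pointTheory X).1) : ⟨n, R⟩ ∈ X := by
  obtain ⟨_, hx⟩ := BoundedFormula.realize_exs.1 h
  exact hx

/-! ### Generating sets -/

variable [IsEmpty (L.Relations 0)]

theorem ClE_singleton_pointTheory (X : Set (Σ n, L.Relations n)) :
    ClE {pointTheory X} = {pointTheory X} := by
  simpa [finClosure_singleton] using ClE_image_pointTheory {X}

theorem ClE_empty : ClE (∅ : Set (CTheory L)) = ∅ := by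
  simpa [finClosure_empty] using ClE_image_pointTheory (L := L) ∅

theorem isLeastGeneratingSet_singleton (X : Set (Σ n, L.Relations n)) :
    IsLeastGeneratingSet {pointTheory X} {pointTheory X} := by
  have not_empty : ¬ IsGeneratingSet (∅ : Set (CTheory L)) {pointTheory X} := fun h =>
    Set.singleton_ne_empty _ (h.2.trans ClE_empty)
  refine ⟨⟨⟨subset_rfl, (ClE_singleton_pointTheory X).symm⟩, fun 𝒢 h𝒢 => ?_⟩, fun 𝒢 h𝒢 => ?_⟩
  · rwa [Set.ssubset_singleton_iff.1 h𝒢]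
  · rcases Set.subset_singleton_iff_eq.1 h𝒢.1 with rfl | rfl
    · exact absurd h𝒢 not_empty
    · exact subset_rfl

theorem not_isMinimalGeneratingSet_powerset {S : Set (Σ n, L.Relations n)} (hS : S.Infinite)
    (𝒢 : Set (CTheory L)) : ¬ IsMinimalGeneratingSet 𝒢 (pointTheory '' 𝒫 S) := by
  rintro ⟨⟨hsub, hcl⟩, hmin⟩
  obtain ⟨𝒳, h𝒳, rfl⟩ := Set.subset_image_iff.1 hsub
  rw [ClE_image_pointTheory] at hcl
  have hcl := (pointTheory_injective.image_injective hcl).symm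
  have hne : 𝒳.Nonempty := by
    rw [Set.nonempty_iff_ne_empty]
    rintro rfl
    rw [finClosure_empty] at hcl
    exact Set.notMem_empty (∅ : Set (Σ n, L.Relations n)) (hcl ▸ Set.empty_subset S)
  obtain ⟨X, hX⟩ := hne
  have hss : 𝒳 \ {X} ⊂ 𝒳 := Set.sdiff_singleton_ssubset.2 hX
  refine hmin (pointTheory '' (𝒳 \ {X}))
    (pointTheory_injective.image_strictMono hss)
    ⟨Set.image_mono (hss.subset.trans h𝒳), ?_⟩
  rw [ClE_image_pointTheory, finClosure_diff_singleton hS hcl]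

end EComb

theorem corollary3p13 (L : FirstOrder.Language.{u, v}) [L.IsRelational] [IsEmpty (L.Relations 0)]
    (S₀ : Set (Σ n, L.Relations n)) (hS₀ : S₀.Infinite) :
    ∃ (J : Type (max u v)) (𝒯 : J → Set (EComb.CTheory L)),
      EComb.FamiliesDisjoint S₀ 𝒯 ∧
      (∀ j, EComb.IsEClosed (𝒯 j) ∧ EComb.HasLeastGeneratingSet (𝒯 j)) ∧
      EComb.IsEClosed (⋃ j, 𝒯 j) ∧
      ¬ EComb.HasLeastGeneratingSet (⋃ j, 𝒯 j) := by
  have hU : ⋃ j : ULift.{max u v} (𝒫 S₀), {EComb.pointTheory j.down.1} =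
      EComb.pointTheory '' 𝒫 S₀ := by
    ext T
    simp [eq_comm]
  refine ⟨ULift.{max u v} (𝒫 S₀), fun j => {EComb.pointTheory j.down.1}, ?_, fun j =>
    ⟨(EComb.ClE_singleton_pointTheory _).symm, _, EComb.isLeastGeneratingSet_singleton _⟩, ?_, ?_⟩
  · rintro j - - _ rfl _ - n R hR ⟨h, -⟩
    exact hR (j.down.2 (EComb.mem_of_nonemptySentence_mem_pointTheory h))
  · rw [hU, EComb.IsEClosed, EComb.ClE_image_pointTheory, EComb.finClosure_powerset]
  · rw [hU]
    rintro ⟨𝒢, h𝒢, -⟩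
    exact EComb.not_isMinimalGeneratingSet_powerset hS₀ 𝒢 h𝒢
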